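/- Let $d\ge 0$ be an integer, let $|\cdot|$ be the Euclidean norm on $\mathbb{R}^d$, and let $K,L\in\mathbb{R}$ with $L\ge 0$. Let $F$ be a function from $\mathbb{R}^d$ into the non-empty compact (not necessarily convex) subsets of $\mathbb{R}^d$ such that $$|y|\le K\quad\text{for all } y\in\bigcup_{z\in\mathbb{R}^d}F(z),\qquad \mathcal{H}\big(F(y),F(z)\big)\le L\,|y-z|\quad\text{for all } y,z\in\mathbb{R}^d,$$ where $\mathcal{H}$ denotes the Hausdorff distance. Let $T\ge 0$, let $x_0\in\mathbb{R}^d$, and let $x:[0,T]\to\mathbb{R}^d$ be a solution of the differential inclusion $$x'(t)\in F\big(x(t)\big),\qquad x(0)=x_0,$$ that is, $x$ is absolutely continuous, $x(0)=x_0$, and $x'(t)\in F(x(t))$ for almost every $t\in[0,T]$. Then for every integer $N\ge 1$, with $\Delta t=T/N$, there exists a solution $\{\xi_n\}_{n=0}^N$ of the Forward Euler scheme $$\xi_{n+1}\in\xi_n+\Delta t\,F(\xi_n),\quad n=0,1,\dots,N-1,\qquad \xi_0=x_0,$$ such that $$\max_{0\le n\le N}|x(n\Delta t)-\xi_n|\le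 K\big(e^{LT}d(d+1)+2d+LTe^{LT}\big)\Delta t.$$ -/

import Mathlib

/-- `x` restricted to `[0, T]` is a solution of the differential inclusion
`x' ∈ F (x)`, `x 0 = x₀`: it is absolutely continuous on `[0, T]`, has the initial value `x₀`, and
for almost every `t ∈ [0, T]` the derivative of `x` (on `[0, T]`) at `t` exists and lies in
`F (x t)`. -/
structure IsInclusionSolution {d : ℕ}
    (F : EuclideanSpace ℝ (Fin d) → Set (EuclideanSpace ℝ (Fin d)))
    (x₀ : EuclideanSpace ℝ (Fin d)) (T : ℝ) (x : ℝ → EuclideanSpace ℝ (Fin d)) : Prop where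
  absolutelyContinuous : AbsolutelyContinuousOnInterval x 0 T
  initial : x 0 = x₀
  ae_deriv_mem : ∀ᵐ t ∂(MeasureTheory.volume.restrict (Set.Icc (0 : ℝ) T)),
    ∃ v ∈ F (x t), HasDerivWithinAt x v (Set.Icc (0 : ℝ) T) t

/-- The terms `ξ 0, …, ξ N` form a solution of the Forward Euler scheme with step `Δt`:
`ξ (n + 1) ∈ ξ n + Δt F (ξ n)` for `0 ≤ n ≤ N - 1`, and `ξ 0 = x₀`.
The terms beyond index `N` are irrelevant. -/
structure IsForwardEulerSolution {d : ℕ}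
    (F : EuclideanSpace ℝ (Fin d) → Set (EuclideanSpace ℝ (Fin d)))
    (x₀ : EuclideanSpace ℝ (Fin d)) (Δt : ℝ) (N : ℕ) (ξ : ℕ → EuclideanSpace ℝ (Fin d)) :
    Prop where
  initial : ξ 0 = x₀
  step : ∀ n < N, ∃ v ∈ F (ξ n), ξ (n + 1) = ξ n + Δt • v

/-!
Write `h = T / N` and `y n = x (n h)`. The mean velocity of `x` over an interval lies in every
closed convex set that contains the velocities. Since `F` is `L`-Lipschitz and `x` is
`K`-Lipschitz, `x' t ∈ F (x t)` lies within `L K h` of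
`co F (y n)` on the `n`-th mesh interval, so `y (n + 1) - y n = h • (q n + error)` with
`q n ∈ co F (y n)` and error at most `L K h`
(`IsInclusionSolution.exists_mem_convexHull_norm_sub_sub_smul_le`). So `y` almost solves the Euler
scheme of the *convexified* inclusion.

The passage back to the nonconvex `F` is a vector-balancing argument: there are `w n ∈ F (y n)`
such that every partial sum of `w - q` has norm at most `2 K d`, independently of `N`
(`exists_forall_norm_sum_sub_le`). It rests on a Shapley–Folkman lemma
(`exists_sum_eq_card_filter_notMem_le_finrank`): a sum of points of convex hulls can be rewritten so
that all but `d` summands lie in the sets themselves. Applying it to one more summand at a time,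
and never touching the summands that already lie in their sets, makes the final choice good for all
partial sums at once.

The Euler solution `ξ` takes at step `n` the velocity of `F (ξ n)` nearest to `w n`, which is at
distance at most `L ‖ξ n - y n‖` from it. Summing up,
`‖ξ n - y n‖ ≤ 2 K d h + L K T h + h L ∑ k < n, ‖ξ k - y k‖`, and a discrete Gronwall inequality
gives the bound `K (2 d + L T) exp (L T) h`. This suffices, as `2 d ≤ d (d + 1)` for every natural
number `d`.
-/

open MeasureTheory Finset

/-! ### Increments of absolutely continuous curves -/

section Increments

variable {E : Type*} [NormedAddCommGroup E] [NormedSpace ℝ E]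

theorem AbsolutelyContinuousOnInterval.clm_comp {x : ℝ → E} {a b : ℝ}
    (hx : AbsolutelyContinuousOnInterval x a b) (f : E →L[ℝ] ℝ) :
    AbsolutelyContinuousOnInterval (fun t => f (x t)) a b := by
  refine squeeze_zero (fun t => Finset.sum_nonneg fun i _ => dist_nonneg) (fun t => ?_)
    (by simpa using Filter.Tendsto.const_mul ‖f‖ hx)
  rw [Finset.mul_sum]
  exact Finset.sum_le_sum fun i _ => f.lipschitz.dist_le_mul _ _

/-- A mean value theorem: if the derivative lies almost everywhere in a closed convex set `C`, so
does the mean velocity. A functional separating the mean velocity from `C` would contradict the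
fundamental theorem of calculus for its composition with `x`. -/
theorem AbsolutelyContinuousOnInterval.exists_mem_sub_eq_smul {x : ℝ → E} {a b : ℝ}
    (hab : a ≤ b) (hx : AbsolutelyContinuousOnInterval x a b) {C : Set E} (hC : Convex ℝ C)
    (hC' : IsClosed C) (hne : C.Nonempty)
    (h : ∀ᵐ t ∂(volume.restrict (Set.Icc a b)), ∃ v ∈ C, HasDerivAt x v t) :
    ∃ q ∈ C, x b - x a = (b - a) • q := by
  rcases hab.eq_or_lt with rfl | hlt
  · obtain ⟨q, hq⟩ := hne
    exact ⟨q, hq, by simp⟩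
  have hpos : 0 < b - a := sub_pos.2 hlt
  refine ⟨(b - a)⁻¹ • (x b - x a), ?_, by rw [smul_inv_smul₀ hpos.ne']⟩
  by_contra hq
  obtain ⟨f, u, hfu, hu⟩ := geometric_hahn_banach_closed_point hC hC' hq
  have hac := hx.clm_comp f
  have hle : ∫ t in a..b, deriv (fun t => f (x t)) t ≤ ∫ _ in a..b, u := by
    refine intervalIntegral.integral_mono_ae_restrict hab hac.intervalIntegrable_deriv
      intervalIntegrable_const ?_
    filter_upwards [h] with t ⟨v, hv, hd⟩
    have hfd : HasDerivAt (fun t => f (x t)) (f v) t := f.hasFDerivAt.comp_hasDerivAt t hd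
    rw [hfd.deriv]
    exact (hfu v hv).le
  rw [hac.integral_deriv_eq_sub, intervalIntegral.integral_const, ← map_sub, smul_eq_mul] at hle
  rw [map_smul, smul_eq_mul, ← div_eq_inv_mul, lt_div_iff₀ hpos] at hu
  linarith

end Increments

/-! ### A Shapley–Folkman lemma -/

/-- A point of `convexHull ℝ V` outside `V` is not extreme, so it is the midpoint of a
nondegenerate segment in the hull. -/
theorem exists_ne_zero_forall_abs_le_one_add_smul_mem {E : Type*} [AddCommGroup E]
    [Module ℝ E] {V : Set E} {c : E}
    (hc : c ∈ convexHull ℝ V) (hcV : c ∉ V) :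
    ∃ u : E, u ≠ 0 ∧ ∀ r : ℝ, |r| ≤ 1 → c + r • u ∈ convexHull ℝ V := by
  have hext : c ∉ (convexHull ℝ V).extremePoints ℝ := fun h =>
    hcV (extremePoints_convexHull_subset h)
  rw [mem_extremePoints_iff_left] at hext
  push Not at hext
  obtain ⟨a, ha, b, hb, ⟨s, t, hs, ht, hst, rfl⟩, hne⟩ := hext hc
  have hab : b - a ≠ 0 := by
    intro h
    obtain rfl : b = a := sub_eq_zero.1 h
    exact hne (by rw [← add_smul, hst, one_smul])
  have hm : 0 < min s t := lt_min hs ht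
  refine ⟨min s t • (b - a), smul_ne_zero hm.ne' hab, fun r hr => ?_⟩
  have h2 : |r * min s t| ≤ min s t := by
    rw [abs_mul, abs_of_pos hm]; exact mul_le_of_le_one_left hm.le hr
  have h3 := abs_le.1 h2
  have : s • a + t • b + r • min s t • (b - a) =
      (s - r * min s t) • a + (t + r * min s t) • b := by module
  rw [this]
  exact (convex_convexHull ℝ V) ha hb (by linarith [min_le_left s t])
    (by linarith [min_le_right s t]) (by linarith)

section FiniteDimensional

variable {E : Type*} [NormedAddCommGroup E] [NormedSpace ℝ E] [FiniteDimensional ℝ E]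

/-- By Carathéodory's theorem the hull is a finite union of continuous images of the compact sets
`stdSimplex ℝ (Fin n) ×ˢ V ^ n` with `n ≤ finrank ℝ E + 1`. -/
theorem IsCompact.convexHull_of_finiteDimensional {V : Set E} (hV : IsCompact V) :
    IsCompact (convexHull ℝ V) := by
  have key : convexHull ℝ V = ⋃ n ∈ Finset.range (Module.finrank ℝ E + 2),
      (fun p : (Fin n → ℝ) × (Fin n → E) => ∑ i, p.1 i • p.2 i) ''
        (stdSimplex ℝ (Fin n) ×ˢ Set.univ.pi fun _ => V) := by
    ext y
    simp only [Set.mem_iUnion]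
    constructor
    · intro hy
      obtain ⟨ι, _, z, w, hz, hind, hw, hw1, rfl⟩ := eq_pos_convex_span_of_mem_convexHull hy
      have hcard : Fintype.card ι ≤ Module.finrank ℝ E + 1 :=
        hind.card_le_finrank_succ.trans (Nat.succ_le_succ (Submodule.finrank_le _))
      let e := Fintype.equivFin ι
      refine ⟨Fintype.card ι, Finset.mem_range.2 (by omega),
        (fun i => w (e.symm i), fun i => z (e.symm i)),
        ⟨⟨fun i => (hw _).le, ?_⟩, fun i _ => hz ⟨_, rfl⟩⟩, ?_⟩
      · rw [← hw1]; exact e.symm.sum_comp w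
      · exact e.symm.sum_comp fun i => w i • z i
    · rintro ⟨n, -, ⟨w, z⟩, ⟨⟨hw, hw1⟩, hz⟩, rfl⟩
      exact (convex_convexHull ℝ V).sum_mem (fun i _ => hw i) hw1
        fun i _ => subset_convexHull ℝ V (hz i trivial)
  rw [key]
  refine Finset.isCompact_biUnion _ fun n _ => IsCompact.image ?_ (by fun_prop)
  exact (isCompact_stdSimplex ℝ (Fin n)).prod (isCompact_univ_pi fun _ => hV)

open Classical in
/-- **Shapley–Folkman lemma** for compact sets. The new decomposition is an extreme point of the
compact set of all decompositions of the given sum: if more than `finrank ℝ E` summands were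
outside their sets, a linear relation between directions in which these can be moved would exhibit
it as a midpoint of two other decompositions. -/
theorem exists_sum_eq_card_filter_notMem_le_finrank {ι : Type*} (S : Finset ι) {V : ι → Set E}
    (hV : ∀ k, IsCompact (V k)) {c : ι → E} (hc : ∀ k, c k ∈ convexHull ℝ (V k)) :
    ∃ c' : ι → E, (∀ k, c' k ∈ convexHull ℝ (V k)) ∧ ∑ k ∈ S, c' k = ∑ k ∈ S, c k ∧
      #{k ∈ S | c' k ∉ V k} ≤ Module.finrank ℝ E := by
  set P : Set (ι → E) := (Set.univ.pi fun k => convexHull ℝ (V k)) ∩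
    {p | ∑ k ∈ S, p k = ∑ k ∈ S, c k}
  have hPc : IsCompact P :=
    (isCompact_univ_pi fun k => (hV k).convexHull_of_finiteDimensional).inter_right
      (isClosed_eq (by fun_prop) continuous_const)
  obtain ⟨p, hp⟩ := hPc.extremePoints_nonempty ⟨c, fun k _ => hc k, rfl⟩
  obtain ⟨⟨hpV, hpS⟩, hext⟩ := mem_extremePoints_iff_left.1 hp
  refine ⟨p, fun k => hpV k trivial, hpS, ?_⟩
  by_contra! hcard
  set B : Finset ι := {k ∈ S | p k ∉ V k}
  have hu : ∀ k, ∃ u : E, (k ∈ B → u ≠ 0) ∧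
      ∀ r : ℝ, |r| ≤ 1 → p k + r • u ∈ convexHull ℝ (V k) := by
    intro k
    by_cases hk : p k ∈ V k
    · exact ⟨0, fun h => absurd hk (Finset.mem_filter.1 h).2, fun r _ => by
        simpa using hpV k trivial⟩
    · obtain ⟨u, hu0, hu⟩ := exists_ne_zero_forall_abs_le_one_add_smul_mem (hpV k trivial) hk
      exact ⟨u, fun _ => hu0, hu⟩
  choose u hu0 hu using hu
  -- More than `finrank ℝ E` directions are dependent; the relation is scaled to coefficients in
  -- `[-1, 1]`, so that moving by it in either direction stays in the hulls and keeps the sum.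
  have hdep : ¬ LinearIndependent ℝ fun k : B => u k := fun h => by
    have := h.fintype_card_le_finrank
    simp only [Fintype.card_coe] at this
    omega
  obtain ⟨g, hg, ⟨k₀, hk₀⟩, hg0⟩ := Fintype.not_linearIndependent_iff.1 hdep
  have hMg : ∀ k : B, |g k| ≤ ∑ k, |g k| := fun k =>
    Finset.single_le_sum (f := fun k => |g k|) (fun _ _ => abs_nonneg _) (Finset.mem_univ k)
  set M := ∑ k, |g k|
  have hMpos : 0 < M := (abs_pos.2 hg0).trans_le (hMg _)
  let a : ι → ℝ := fun k => if h : k ∈ B then g ⟨k, h⟩ / M else 0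
  have ha : ∀ k, |a k| ≤ 1 := by
    intro k
    by_cases h : k ∈ B
    · simp only [a, h, dif_pos, abs_div, abs_of_pos hMpos]
      exact (div_le_one hMpos).2 (hMg _)
    · simp [a, h]
  have hsum : ∑ k ∈ S, a k • u k = 0 := by
    have h1 : ∑ k ∈ S, a k • u k = ∑ k ∈ B, a k • u k :=
      (Finset.sum_subset (Finset.filter_subset _ _) fun k _ hk => by
        have hk' : k ∉ B := hk
        simp only [a, dif_neg hk', zero_smul]).symm
    rw [h1, ← Finset.sum_coe_sort]
    calc ∑ k : B, a k • u k = ∑ k : B, M⁻¹ • (g k • u k) :=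
          Finset.sum_congr rfl fun k _ => by
            simp only [a, k.2, dif_pos, smul_smul, div_eq_inv_mul]
      _ = 0 := by rw [← Finset.smul_sum, hg, smul_zero]
  have hmem : ∀ r : ℝ, |r| ≤ 1 → (fun k => p k + (r * a k) • u k) ∈ P := by
    intro r hr
    refine ⟨fun k _ => hu k _ ?_, ?_⟩
    · rw [abs_mul]; exact mul_le_one₀ hr (abs_nonneg _) (ha k)
    · show ∑ k ∈ S, (p k + (r * a k) • u k) = _
      simp_rw [mul_smul]
      rw [Finset.sum_add_distrib, ← Finset.smul_sum, hsum, smul_zero, add_zero]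
      exact hpS
  have heq := hext _ (hmem 1 (by simp)) _ (hmem (-1) (by simp))
    ⟨1 / 2, 1 / 2, by norm_num, by norm_num, by norm_num, by ext k : 1; simp; module⟩
  have h0 := congrFun heq k₀
  have h1 : a k₀ • u k₀ = 0 := by simpa using h0
  rcases smul_eq_zero.1 h1 with h | h
  · simp only [a, hk₀, dif_pos] at h
    exact (div_ne_zero hg0 hMpos.ne') h
  · exact hu0 k₀ hk₀ h

/-! ### Balanced selections -/

/-- Points `q k` of convex hulls can be replaced by points `w k` of the sets themselves so that all
partial sums up to `N` change by a bounded amount that does not depend on `N`. -/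
theorem exists_forall_norm_sum_sub_le {V : ℕ → Set E} (hV : ∀ k, IsCompact (V k))
    {K : ℝ} (hK : ∀ k, ∀ v ∈ V k, ‖v‖ ≤ K) {q : ℕ → E}
    (hq : ∀ k, q k ∈ convexHull ℝ (V k)) (N : ℕ) :
    ∃ w : ℕ → E, (∀ k, w k ∈ V k) ∧
      ∀ n ≤ N, ‖∑ k ∈ range n, (w k - q k)‖ ≤ Module.finrank ℝ E * (2 * K) := by
  classical
  have hne : ∀ k, (V k).Nonempty := fun k => convexHull_nonempty_iff.1 ⟨_, hq k⟩
  have hK0 : 0 ≤ K := by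
    obtain ⟨v, hv⟩ := hne 0
    exact (norm_nonneg v).trans (hK 0 v hv)
  have hball : ∀ k, ∀ v ∈ convexHull ℝ (V k), ‖v‖ ≤ K := fun k v hv => by
    have : convexHull ℝ (V k) ⊆ Metric.closedBall 0 K :=
      convexHull_min (fun v hv => by simpa using hK k v hv) (convex_closedBall _ _)
    simpa using this hv
  -- `c` redistributes the first `N` summands so that few of them lie outside their sets. The sums
  -- are controlled for every selection `w` that keeps the summands of `c` already in their sets,
  -- which leaves the others free to be redistributed again at the next stage.
  suffices H : ∃ c : ℕ → E, (∀ k, c k ∈ convexHull ℝ (V k)) ∧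
      ∑ k ∈ range N, c k = ∑ k ∈ range N, q k ∧
      ∀ w : ℕ → E, (∀ k, w k ∈ V k) → (∀ k < N, c k ∈ V k → w k = c k) →
        ∀ n ≤ N, ‖∑ k ∈ range n, (w k - q k)‖ ≤ Module.finrank ℝ E * (2 * K) by
    obtain ⟨c, -, -, h⟩ := H
    have hw : ∀ k, ∃ w ∈ V k, c k ∈ V k → w = c k := fun k => by
      by_cases hk : c k ∈ V k
      · exact ⟨c k, hk, fun _ => rfl⟩
      · obtain ⟨v, hv⟩ := hne k
        exact ⟨v, hv, fun h => absurd h hk⟩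
    choose w hw hwc using hw
    exact ⟨w, hw, h w hw fun k _ => hwc k⟩
  induction N with
  | zero =>
    refine ⟨q, hq, rfl, fun w _ _ n hn => ?_⟩
    obtain rfl : n = 0 := by omega
    simpa using by positivity
  | succ N ih =>
    obtain ⟨c, hc, hcsum, hcw⟩ := ih
    -- Shrinking `V k` to `{c k}` prevents the Shapley–Folkman lemma from moving the summands that
    -- already lie in their sets.
    let V' : ℕ → Set E := fun k => if k < N ∧ c k ∈ V k then {c k} else V k
    have hV'V : ∀ k, V' k ⊆ V k := fun k => by
      by_cases h : k < N ∧ c k ∈ V k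
      · simp [V', h]
      · simp [V', h]
    have hV'c : ∀ k, IsCompact (V' k) := fun k => by
      by_cases h : k < N ∧ c k ∈ V k
      · simp [V', h]
      · simpa [V', h] using hV k
    let c₀ : ℕ → E := fun k => if k < N then c k else q k
    have hc₀ : ∀ k, c₀ k ∈ convexHull ℝ (V' k) := fun k => by
      by_cases hk : k < N
      · by_cases h : c k ∈ V k
        · simp [V', c₀, h, hk]
        · simpa [V', c₀, h, hk] using hc k
      · simpa [V', c₀, hk] using hq k
    obtain ⟨c', hc', hsum, hcard⟩ :=
      exists_sum_eq_card_filter_notMem_le_finrank (range (N + 1)) hV'c hc₀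
    have hsum' : ∑ k ∈ range (N + 1), c' k = ∑ k ∈ range (N + 1), q k := by
      rw [hsum, Finset.sum_range_succ, Finset.sum_range_succ, ← hcsum]
      congr 1
      · exact Finset.sum_congr rfl fun k hk => by simp [c₀, Finset.mem_range.1 hk]
      · simp [c₀]
    have hfix : ∀ k < N, c k ∈ V k → c' k = c k := fun k hk h => by
      have := hc' k
      simpa [V', hk, h] using this
    refine ⟨c', fun k => convexHull_mono (hV'V k) (hc' k), hsum', fun w hw hwc n hn => ?_⟩
    rcases Nat.lt_or_ge N n with hlt | hle
    · obtain rfl : n = N + 1 := by omega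
      -- Against `c'` instead of `q`, only the few summands outside their sets contribute.
      rw [Finset.sum_sub_distrib, ← hsum', ← Finset.sum_sub_distrib]
      calc ‖∑ k ∈ range (N + 1), (w k - c' k)‖
          = ‖∑ k ∈ range (N + 1) with c' k ∉ V' k, (w k - c' k)‖ := by
            congr 1
            refine (Finset.sum_subset (Finset.filter_subset _ _) fun k hk hk' => ?_).symm
            have hkV : c' k ∈ V' k := by
              by_contra h
              exact hk' (Finset.mem_filter.2 ⟨hk, h⟩)
            rw [hwc k (Finset.mem_range.1 hk) (hV'V k hkV), sub_self]
        _ ≤ #{k ∈ range (N + 1) | c' k ∉ V' k} • (2 * K) := by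
            refine (norm_sum_le _ _).trans (Finset.sum_le_card_nsmul _ _ _ fun k _ => ?_)
            have h1 := hK k _ (hw k)
            have h2 := hball k _ (convexHull_mono (hV'V k) (hc' k))
            linarith [norm_sub_le (w k) (c' k)]
        _ ≤ Module.finrank ℝ E * (2 * K) := by
            rw [nsmul_eq_mul]
            gcongr
    · refine hcw w hw (fun k hk h => ?_) n hle
      have := hfix k hk h
      rw [← this]
      exact hwc k (by omega) (by rwa [this])

end FiniteDimensional

/-! ### Discrete Gronwall inequality and nearest points -/

theorem le_mul_one_add_pow_of_le_add_mul_sum {e : ℕ → ℝ} {A c : ℝ} (hc : 0 ≤ c) {N : ℕ}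
    (h : ∀ n ≤ N, e n ≤ A + c * ∑ k ∈ range n, e k) :
    ∀ n ≤ N, e n ≤ A * (1 + c) ^ n := by
  have key : ∀ n ≤ N, A + c * ∑ k ∈ range n, e k ≤ A * (1 + c) ^ n := by
    intro n
    induction n with
    | zero => simp
    | succ n ih =>
      intro hn
      have h1 := ih (by omega)
      have h2 := h n (by omega)
      rw [Finset.sum_range_succ, pow_succ]
      nlinarith [mul_le_mul_of_nonneg_left (h2.trans h1) hc]
  exact fun n hn => (h n hn).trans (key n hn)

theorem IsCompact.exists_mem_dist_le_hausdorffDist {α : Type*} [PseudoMetricSpace α]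
    {A B : Set α} (hA : IsCompact A) (hB : IsCompact B) (hne : B.Nonempty) {a : α} (ha : a ∈ A) :
    ∃ b ∈ B, dist a b ≤ Metric.hausdorffDist A B := by
  obtain ⟨b, hb, hab⟩ := hB.exists_infDist_eq_dist hne a
  refine ⟨b, hb, hab ▸ Metric.infDist_le_hausdorffDist_of_mem ha ?_⟩
  exact Metric.hausdorffEDist_ne_top_of_nonempty_of_bounded ⟨a, ha⟩ hne hA.isBounded hB.isBounded

/-! ### Local error of a solution of the inclusion -/

section Inclusion

variable {d : ℕ} {F : EuclideanSpace ℝ (Fin d) → Set (EuclideanSpace ℝ (Fin d))}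
  {x₀ : EuclideanSpace ℝ (Fin d)} {T : ℝ} {x : ℝ → EuclideanSpace ℝ (Fin d)}

theorem IsInclusionSolution.exists_mem_sub_eq_smul (hx : IsInclusionSolution F x₀ T x) {a b : ℝ}
    (ha : 0 ≤ a) (hab : a ≤ b) (hb : b ≤ T) {C : Set (EuclideanSpace ℝ (Fin d))}
    (hC : Convex ℝ C) (hC' : IsClosed C) (hne : C.Nonempty)
    (hF : ∀ t ∈ Set.Icc a b, F (x t) ⊆ C) :
    ∃ q ∈ C, x b - x a = (b - a) • q := by
  have hsub : Set.Icc a b ⊆ Set.Icc 0 T := Set.Icc_subset_Icc ha hb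
  refine AbsolutelyContinuousOnInterval.exists_mem_sub_eq_smul hab
    (hx.absolutelyContinuous.mono ?_) hC hC' hne ?_
  · rwa [Set.uIcc_of_le hab, Set.uIcc_of_le (ha.trans (hab.trans hb))]
  · have h1 := ae_mono (Measure.restrict_mono_set volume hsub) hx.ae_deriv_mem
    have h2 : ∀ᵐ t ∂(volume.restrict (Set.Icc a b)), t ∈ Set.Ioo a b := by
      rw [← restrict_Ioo_eq_restrict_Icc]
      exact ae_restrict_mem measurableSet_Ioo
    filter_upwards [h1, h2] with t ⟨v, hv, hd⟩ ht
    exact ⟨v, hF t (Set.Ioo_subset_Icc_self ht) hv, hd.hasDerivAt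
      (Icc_mem_nhds (ha.trans_lt ht.1) (ht.2.trans_le hb))⟩

theorem IsInclusionSolution.norm_sub_le (hx : IsInclusionSolution F x₀ T x) {K : ℝ}
    (hK : 0 ≤ K) (hF : ∀ z, ∀ y ∈ F z, ‖y‖ ≤ K) {a b : ℝ} (ha : 0 ≤ a) (hab : a ≤ b)
    (hb : b ≤ T) : ‖x b - x a‖ ≤ K * (b - a) := by
  obtain ⟨q, hq, h⟩ := hx.exists_mem_sub_eq_smul ha hab hb (convex_closedBall 0 K)
    Metric.isClosed_closedBall (Metric.nonempty_closedBall.2 hK)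
    fun t _ v hv => by simpa using hF _ v hv
  rw [h, norm_smul, Real.norm_of_nonneg (sub_nonneg.2 hab), mul_comm]
  exact mul_le_mul_of_nonneg_right (by simpa using hq) (sub_nonneg.2 hab)

/-- Over a time step `b - a` a solution moves as in an Euler step of the convexified inclusion, up to
an error of second order. -/
theorem IsInclusionSolution.exists_mem_convexHull_norm_sub_sub_smul_le
    (hx : IsInclusionSolution F x₀ T x) (hF_nonempty : ∀ z, (F z).Nonempty)
    (hF_compact : ∀ z, IsCompact (F z)) {K L : ℝ} (hK : 0 ≤ K) (hL : 0 ≤ L)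
    (hF_bound : ∀ z, ∀ y ∈ F z, ‖y‖ ≤ K)
    (hF_lipschitz : ∀ y z, Metric.hausdorffDist (F y) (F z) ≤ L * ‖y - z‖)
    {a b : ℝ} (ha : 0 ≤ a) (hab : a ≤ b) (hb : b ≤ T) :
    ∃ q ∈ convexHull ℝ (F (x a)),
      ‖x b - x a - (b - a) • q‖ ≤ (b - a) * (L * (K * (b - a))) := by
  have hba : 0 ≤ b - a := sub_nonneg.2 hab
  have hco := (hF_compact (x a)).convexHull_of_finiteDimensional
  have hne : (convexHull ℝ (F (x a))).Nonempty := (hF_nonempty _).convexHull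
  obtain ⟨p, hp, hxp⟩ := hx.exists_mem_sub_eq_smul ha hab hb
    (C := Metric.cthickening (L * (K * (b - a))) (convexHull ℝ (F (x a))))
    ((convex_convexHull ℝ _).cthickening _) Metric.isClosed_cthickening
    (hne.mono (Metric.self_subset_cthickening _)) fun t ht v hv => by
      obtain ⟨v', hv', hd⟩ := (hF_compact (x t)).exists_mem_dist_le_hausdorffDist
        (hF_compact (x a)) (hF_nonempty _) hv
      refine Metric.mem_cthickening_of_dist_le v v' _ _ (subset_convexHull ℝ _ hv')
        (hd.trans ((hF_lipschitz _ _).trans (mul_le_mul_of_nonneg_left ?_ hL)))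
      refine (hx.norm_sub_le hK hF_bound ha ht.1 (ht.2.trans hb)).trans ?_
      exact mul_le_mul_of_nonneg_left (by linarith [ht.2]) hK
  rw [hco.cthickening_eq_biUnion_closedBall (by positivity)] at hp
  simp only [Set.mem_iUnion, Metric.mem_closedBall, dist_eq_norm] at hp
  obtain ⟨q, hq, hpq⟩ := hp
  refine ⟨q, hq, ?_⟩
  rw [hxp, ← smul_sub, norm_smul, Real.norm_of_nonneg hba]
  exact mul_le_mul_of_nonneg_left hpq hba

end Inclusion

/-! ### Convergence of the Forward Euler scheme -/

theorem mainTheorem1 (d : ℕ)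
    (F : EuclideanSpace ℝ (Fin d) → Set (EuclideanSpace ℝ (Fin d)))
    (hF_nonempty : ∀ z, (F z).Nonempty)
    (hF_compact : ∀ z, IsCompact (F z))
    (K L : ℝ) (hL : 0 ≤ L)
    (hF_bound : ∀ z, ∀ y ∈ F z, ‖y‖ ≤ K)
    (hF_lipschitz : ∀ y z, Metric.hausdorffDist (F y) (F z) ≤ L * ‖y - z‖)
    (x₀ : EuclideanSpace ℝ (Fin d)) (T : ℝ) (hT : 0 ≤ T)
    (x : ℝ → EuclideanSpace ℝ (Fin d)) (hx : IsInclusionSolution F x₀ T x)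
    (N : ℕ) (hN : 1 ≤ N) :
    ∃ ξ : ℕ → EuclideanSpace ℝ (Fin d),
      IsForwardEulerSolution F x₀ (T / N) N ξ ∧
      ∀ n ≤ N, ‖x (n * (T / N)) - ξ n‖ ≤
        K * (Real.exp (L * T) * (d * (d + 1)) + 2 * d + L * T * Real.exp (L * T)) * (T / N) := by
  have hK : 0 ≤ K := by
    obtain ⟨v, hv⟩ := hF_nonempty 0
    exact (norm_nonneg v).trans (hF_bound 0 v hv)
  have hN0 : (0 : ℝ) < N := by exact_mod_cast hN
  set h : ℝ := T / N with h_def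
  have hh : 0 ≤ h := by positivity
  have hNh : N * h = T := by rw [h_def]; field_simp
  set y : ℕ → EuclideanSpace ℝ (Fin d) := fun n => x (n * h) with hy
  have hq : ∀ n, ∃ q ∈ convexHull ℝ (F (y n)),
      n < N → ‖y (n + 1) - y n - h • q‖ ≤ h * (L * (K * h)) := by
    intro n
    by_cases hn : n < N
    · have hnN : ((n + 1 : ℕ) : ℝ) * h ≤ T := by
        rw [← hNh]
        exact mul_le_mul_of_nonneg_right (by exact_mod_cast hn) hh
      have hstep : ((n + 1 : ℕ) : ℝ) * h - n * h = h := by push_cast; ring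
      obtain ⟨q, hq, hle⟩ := hx.exists_mem_convexHull_norm_sub_sub_smul_le hF_nonempty hF_compact
        hK hL hF_bound hF_lipschitz (a := n * h) (b := (n + 1 : ℕ) * h) (by positivity)
        (by linarith) hnN
      rw [hstep] at hle
      exact ⟨q, hq, fun _ => hle⟩
    · obtain ⟨v, hv⟩ := hF_nonempty (y n)
      exact ⟨v, subset_convexHull ℝ _ hv, fun h => absurd h hn⟩
  choose q hq hqe using hq
  obtain ⟨w, hw, hwq⟩ := exists_forall_norm_sum_sub_le (fun k => hF_compact (y k))
    (fun k => hF_bound (y k)) hq N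
  rw [finrank_euclideanSpace_fin] at hwq
  have hsel : ∀ (k : ℕ) (z : EuclideanSpace ℝ (Fin d)),
      ∃ v ∈ F z, ‖v - w k‖ ≤ L * ‖z - y k‖ := by
    intro k z
    obtain ⟨v, hv, hd⟩ := (hF_compact (y k)).exists_mem_dist_le_hausdorffDist (hF_compact z)
      (hF_nonempty z) (hw k)
    refine ⟨v, hv, ?_⟩
    rw [← dist_eq_norm, dist_comm, norm_sub_rev z]
    exact hd.trans (hF_lipschitz _ _)
  choose φ hφ hφw using hsel
  let ξ : ℕ → EuclideanSpace ℝ (Fin d) := fun n =>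
    Nat.rec x₀ (fun k z => z + h • φ k z) n
  have hξ : ∀ n, ξ (n + 1) = ξ n + h • φ n (ξ n) := fun n => rfl
  refine ⟨ξ, ⟨rfl, fun n _ => ⟨φ n (ξ n), hφ _ _, hξ n⟩⟩, fun n hn => ?_⟩
  -- The error splits into feedback (velocity at `ξ k` against `y k`), selection (`w` against `q`)
  -- and the local error of the convexified scheme.
  have hdecomp : ∀ n, ξ n - y n = h • ∑ k ∈ range n, (φ k (ξ k) - w k) +
      h • ∑ k ∈ range n, (w k - q k) - ∑ k ∈ range n, (y (k + 1) - y k - h • q k) := by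
    intro n
    induction n with
    | zero => simp [ξ, hy, hx.initial]
    | succ n ih =>
      simp only [Finset.sum_range_succ]
      have : ξ (n + 1) - y (n + 1) =
          (ξ n - y n) + h • φ n (ξ n) - (y (n + 1) - y n) := by rw [hξ]; abel
      rw [this, ih]
      module
  set A : ℝ := h * (d * (2 * K)) + T * (L * (K * h)) with hA
  have hA0 : 0 ≤ A := by positivity
  have hrec : ∀ n ≤ N, ‖ξ n - y n‖ ≤ A + (h * L) * ∑ k ∈ range n, ‖ξ k - y k‖ := by
    intro n hn
    have h1 : ‖h • ∑ k ∈ range n, (φ k (ξ k) - w k)‖ ≤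
        (h * L) * ∑ k ∈ range n, ‖ξ k - y k‖ := by
      rw [norm_smul, Real.norm_of_nonneg hh, mul_assoc, Finset.mul_sum _ _ L]
      exact mul_le_mul_of_nonneg_left
        ((norm_sum_le _ _).trans (Finset.sum_le_sum fun k _ => hφw k _)) hh
    have h2 : ‖h • ∑ k ∈ range n, (w k - q k)‖ ≤ h * (d * (2 * K)) := by
      rw [norm_smul, Real.norm_of_nonneg hh]
      exact mul_le_mul_of_nonneg_left (hwq n hn) hh
    have h3 : ‖∑ k ∈ range n, (y (k + 1) - y k - h • q k)‖ ≤ T * (L * (K * h)) := by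
      calc _ ≤ ∑ k ∈ range n, h * (L * (K * h)) :=
            (norm_sum_le _ _).trans (Finset.sum_le_sum fun k hk =>
              hqe k ((Finset.mem_range.1 hk).trans_le hn))
        _ = n * (h * (L * (K * h))) := by simp
        _ ≤ N * (h * (L * (K * h))) := by gcongr
        _ = T * (L * (K * h)) := by rw [← mul_assoc, hNh]
    rw [hdecomp n]
    refine (norm_sub_le _ _).trans ?_
    linarith [norm_add_le (h • ∑ k ∈ range n, (φ k (ξ k) - w k))
      (h • ∑ k ∈ range n, (w k - q k))]
  have hpow : (1 + h * L) ^ n ≤ Real.exp (L * T) := by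
    calc (1 + h * L) ^ n ≤ Real.exp (h * L) ^ n := by
          refine pow_le_pow_left₀ (by positivity) ?_ n
          linarith [Real.add_one_le_exp (h * L)]
      _ = Real.exp (n * (h * L)) := (Real.exp_nat_mul _ _).symm
      _ ≤ Real.exp (N * (h * L)) := by gcongr
      _ = Real.exp (L * T) := by rw [← mul_assoc, hNh, mul_comm]
  have hd : (2 * d : ℝ) ≤ d * (d + 1) := by
    rcases Nat.eq_zero_or_pos d with rfl | hd
    · simp
    · have : (1 : ℝ) ≤ d := by exact_mod_cast hd
      nlinarith
  calc ‖x (n * h) - ξ n‖ = ‖ξ n - y n‖ := norm_sub_rev _ _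
    _ ≤ A * (1 + h * L) ^ n :=
      le_mul_one_add_pow_of_le_add_mul_sum (mul_nonneg hh hL) hrec n hn
    _ ≤ A * Real.exp (L * T) := by gcongr
    _ = K * (Real.exp (L * T) * (2 * d) + L * T * Real.exp (L * T)) * h := by rw [hA]; ring
    _ ≤ K * (Real.exp (L * T) * (d * (d + 1)) + 2 * d + L * T * Real.exp (L * T)) * h := by
      gcongr
      exact (mul_le_mul_of_nonneg_left hd (Real.exp_pos _).le).trans
        (le_add_of_nonneg_right (by positivity))
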